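/- For a probability distribution $p=(p_k)_{k\ge 0}$ on $\mathbb{N}=\{0,1,2,\dots\}$ let $H(p)=\sum_{k\ge 0}-p_k\log p_k\in[0,\infty]$ be its entropy (with $0\log 0=0$) and, for $n\in\mathbb{N}$, let $H_n(p)=\sum_{k\ge n}-p_k\log p_k\in[0,\infty]$ be its tail entropy of order $n$. Let $\rho:\mathbb{N}\to[0,\infty)$ be any function with $\rho(n)\to 0$ as $n\to\infty$, and let $\mathcal{P}$ be the class of all probability distributions $p$ on $\mathbb{N}$ for which there is a number $N_p$ such that $H_n(p)\le\rho(n)$ for all $n\ge N_p$ (in particular $H(p)<\infty$ for $p\in\mathcal{P}$). Let $A\subseteq\mathbb{R}^+=[0,\infty)$ be any set, and let $A^c=\mathbb{R}^+\setminus A$. The entropy prediction problem for $(\mathcal{P},A)$ is called eventually almost surely (e.a.s.) predictable if there is a function $\Phi$ from the finite strings over $\mathbb{N}$ to the set of two predictions $\{\text{``}H(p)\in A\text{''},\ \text{``}H(p)\in A^c\text{''}\}$ such that for every $p\in\mathcal{P}$, when $X_1,X_2,\dots$ are independent with law $p$, with probability $1$ the prediction $\Phi(X_1,\dots,X_{n-1})$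 is wrong for only finitely many $n\ge 1$. Two sets $A,B\subseteq\mathbb{R}$ are called $F_\sigma$-separable if there are closed sets $A_1\subseteq A_2\subseteq\cdots$ and $B_1\subseteq B_2\subseteq\cdots$ in $\mathbb{R}$ with $\bigcup_n A_n=A$, $\bigcup_n B_n=B$ and $A_n\cap B_n=\emptyset$ for every $n$. Then the entropy prediction problem for $(\mathcal{P},A)$ is e.a.s. predictable if and only if $A$ and $A^c$ are $F_\sigma$-separable. -/

import Mathlib

open MeasureTheory Filter Topology
open scoped ENNReal

noncomputable section

/-- The string of the first `n` observations `x 0, …, x (n - 1)` of a sequence `x`. -/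
def firstObs {X : Type*} (x : ℕ → X) (n : ℕ) : List X :=
  List.ofFn fun i : Fin n => x i

/-- Eventually almost sure predictability of a class `P` of models, where the model `p` generates
the observed process with law `law p`, under a loss `loss` with values `0` and `1`.
One prediction rule `Φ`, defined on finite strings, has to work for all models of `P`: at step
`n + 1` it predicts from the first `n` observations, and the loss is then evaluated
on the first `n + 1` observations. -/
def EASPredictable {M X Y : Type*} [MeasurableSpace X] (law : M → Measure (ℕ → X)) (P : Set M)
    (loss : M → List X → Y → Fin 2) : Prop :=
  ∃ Φ : List X → Y, ∀ p ∈ P, ∀ᵐ x ∂(law p),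
    ∑' n : ℕ, (((loss p (firstObs x (n + 1)) (Φ (firstObs x n)) : Fin 2) : ℕ) : ℝ≥0∞) < ∞

/-- The law of an i.i.d. sequence with one-dimensional marginal `p`. -/
def iidLaw (p : PMF ℕ) : Measure (ℕ → ℕ) :=
  Measure.infinitePi fun _ : ℕ => p.toMeasure

/-- The tail entropy `∑_{k ≥ n} -p_k log p_k` of order `n`, as an element of `[0, ∞]`
(all the terms are nonnegative since `0 ≤ p_k ≤ 1`). -/
def tailEntropy (p : PMF ℕ) (n : ℕ) : ℝ≥0∞ :=
  ∑' k : ℕ, if n ≤ k then ENNReal.ofReal (Real.negMulLog (p k).toReal) else 0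

/-- The Shannon entropy, in `[0, ∞]`. -/
def entropy (p : PMF ℕ) : ℝ≥0∞ :=
  ∑' k : ℕ, ENNReal.ofReal (Real.negMulLog (p k).toReal)

/-- The class of all distributions on `ℕ` whose tail entropy is eventually dominated by `ρ`. -/
def dominatedClass (ρ : ℕ → ℝ) : Set (PMF ℕ) :=
  {p | ∃ N : ℕ, ∀ n ≥ N, tailEntropy p n ≤ ENNReal.ofReal (ρ n)}

open Classical in
/-- The entropy loss: the prediction `true` says that the entropy lies in `A`, the prediction
`false` says that it lies in `[0, ∞) \ A`; the loss is `0` if what is said is right,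
and `1` otherwise. -/
def entropyLoss (A : Set ℝ) (p : PMF ℕ) (_ : List ℕ) (y : Bool) : Fin 2 :=
  if entropy p ∈ ENNReal.ofReal '' (if y = true then A else Set.Ici 0 \ A) then 0 else 1

/-- Two sets of reals are `F_σ`-separable: they are increasing unions of closed sets
`F 0 ⊆ F 1 ⊆ …` and `G 0 ⊆ G 1 ⊆ …` such that `F n` and `G n` are disjoint for every `n`. -/
def FSigmaSeparable (A B : Set ℝ) : Prop :=
  ∃ F G : ℕ → Set ℝ, Monotone F ∧ Monotone G ∧ (⋃ n, F n) = A ∧ (⋃ n, G n) = B ∧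
    ∀ n, IsClosed (F n) ∧ IsClosed (G n) ∧ Disjoint (F n) (G n)

end

/-! Necessity uses only finitely supported distributions, which belong to the class for every `ρ`.
For each `M`, mixing the point mass at `0` with the uniform law on `{0, …, M}` gives a path in `t ∈
[0, 1]` whose entropy runs continuously from `0` to `log (M + 1)`. On a finite alphabet,
probabilities of finite-horizon events are polynomials in `t`, so the parameters at which `Φ` says
`c` from step `N` on with probability at least `1 / 2` form a compact set. The entropies of these
parameters exhaust the set on which `c` is right (`exists_closed_of_predicts`), so both sets are
increasing unions of closed sets.

Sufficiency: stage `m` estimates the entropy of the letters below `m` from a sample of fixed size,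
uniformly in `p` (`exists_sampleSize`). By Borel–Cantelli and the tail bound, the error is
eventually at most `1 / (m + 1) + ρ m`, a bound known in advance. The nested closed sets turn such
estimates into decisions that are eventually right (`exists_decision`). -/

lemma PMF.toReal_apply_le_one {α : Type*} (p : PMF α) (a : α) : (p a).toReal ≤ 1 :=
  ENNReal.toReal_le_of_le_ofReal zero_le_one (by simpa using p.coe_le_one a)

/-- The set of entropies for which the prediction `y` is right. -/
def predictedSet (A : Set ℝ) (y : Bool) : Set ℝ :=
  if y = true then A else Set.Ici 0 \ A

lemma predictedSet_subset {A : Set ℝ} (hA : A ⊆ Set.Ici 0) (y : Bool) :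
    predictedSet A y ⊆ Set.Ici 0 := by
  cases y
  · simp [predictedSet]
  · simpa [predictedSet] using hA

lemma mem_predictedSet_not_iff {A : Set ℝ} {h : ℝ} (hh : 0 ≤ h) (y : Bool) :
    h ∈ predictedSet A (!y) ↔ h ∉ predictedSet A y := by
  cases y <;> simp [predictedSet, hh]

/-- `ENNReal.ofReal` is injective only on nonnegative reals, hence the need for `A ⊆ [0, ∞)`. -/
lemma entropyLoss_eq_zero_iff {A : Set ℝ} (hA : A ⊆ Set.Ici 0) {p : PMF ℕ} {h : ℝ} (hh : 0 ≤ h)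
    (hp : entropy p = ENNReal.ofReal h) (l : List ℕ) (y : Bool) :
    entropyLoss A p l y = 0 ↔ h ∈ predictedSet A y := by
  have key : entropy p ∈ ENNReal.ofReal '' predictedSet A y ↔ h ∈ predictedSet A y := by
    rw [hp]
    constructor
    · rintro ⟨z, hz, hzh⟩
      rwa [← (ENNReal.ofReal_eq_ofReal_iff (predictedSet_subset hA y hz) hh).1 hzh]
    · exact fun hz => ⟨h, hz, rfl⟩
  rw [← key]
  classical
  change (if entropy p ∈ ENNReal.ofReal '' predictedSet A y then (0 : Fin 2) else 1) = 0 ↔ _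
  split_ifs with hy <;> simp [hy]

lemma tsum_fin_two_lt_top_iff (f : ℕ → Fin 2) :
    ∑' n, (((f n : Fin 2) : ℕ) : ℝ≥0∞) < ∞ ↔ ∀ᶠ n in atTop, f n = 0 := by
  constructor
  · intro h
    have h1 := ENNReal.tendsto_cofinite_zero_of_tsum_ne_top h.ne
    rw [Nat.cofinite_eq_atTop] at h1
    filter_upwards [h1.eventually (gt_mem_nhds zero_lt_one)] with n hn
    have : ((f n : Fin 2) : ℕ) < 1 := by exact_mod_cast hn
    exact Fin.ext (by simpa using this)
  · intro h
    obtain ⟨N, hN⟩ := eventually_atTop.1 h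
    rw [tsum_eq_sum (s := Finset.range N) fun n hn => by
      simp [hN n (by simpa using hn)]]
    exact ENNReal.sum_lt_top.2 fun n _ => ENNReal.natCast_lt_top _

/-- The loss accumulated along `x` is finite iff the predictions are eventually right. -/
lemma tsum_entropyLoss_lt_top_iff {A : Set ℝ} (hA : A ⊆ Set.Ici 0) {p : PMF ℕ} {h : ℝ}
    (hh : 0 ≤ h) (hp : entropy p = ENNReal.ofReal h) (Φ : List ℕ → Bool) (x : ℕ → ℕ) :
    ∑' n : ℕ, (((entropyLoss A p (firstObs x (n + 1)) (Φ (firstObs x n)) : Fin 2) : ℕ) : ℝ≥0∞) < ∞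
      ↔ ∀ᶠ n in atTop, h ∈ predictedSet A (Φ (firstObs x n)) := by
  rw [tsum_fin_two_lt_top_iff]
  simp only [entropyLoss_eq_zero_iff hA hh hp]

/-! ### Finite-horizon events under the i.i.d. law -/

instance isProbabilityMeasure_iidLaw (p : PMF ℕ) : IsProbabilityMeasure (iidLaw p) := by
  unfold iidLaw; infer_instance

lemma measurable_comp_firstObs {Y : Type*} [MeasurableSpace Y] (g : List ℕ → Y) (n : ℕ) :
    Measurable fun x : ℕ → ℕ => g (firstObs x n) := by
  have : (fun x : ℕ → ℕ => g (firstObs x n)) =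
      (fun w : Fin n → ℕ => g (List.ofFn w)) ∘ fun x i => x i := rfl
  rw [this]
  exact (measurable_of_countable _).comp (measurable_pi_lambda _ fun i => measurable_pi_apply _)

/-- The probability of an event that depends on the first `n` observations. -/
lemma iidLaw_real_eq_sum (p : PMF ℕ) {M : ℕ} (hM : ∀ k, M ≤ k → p k = 0) (n : ℕ)
    (S : Set (Fin n → ℕ)) [DecidablePred (· ∈ S)] :
    (iidLaw p).real {x | (fun i : Fin n => x i) ∈ S} =
      ∑ w ∈ Fintype.piFinset fun _ : Fin n => Finset.range M,
        if w ∈ S then ∏ i, (p (w i)).toReal else 0 := by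
  have hmap : (iidLaw p).map (fun x (i : Fin n) => x i) =
      Measure.pi fun _ : Fin n => p.toMeasure := by
    exact (Measure.map_infinitePi_infinitePi_of_inj (P := fun _ : ℕ => p.toMeasure)
      (f := fun i : Fin n => (i : ℕ)) Fin.val_injective).trans (Measure.infinitePi_eq_pi _)
  have hmeas : Measurable fun (x : ℕ → ℕ) (i : Fin n) => x i :=
    measurable_pi_lambda _ fun i => measurable_pi_apply _
  have h1 : iidLaw p {x | (fun i : Fin n => x i) ∈ S} =
      ∑' w : Fin n → ℕ, S.indicator (fun w => ∏ i, p (w i)) w := by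
    have hS : MeasurableSet S := S.to_countable.measurableSet
    change iidLaw p ((fun x (i : Fin n) => x i) ⁻¹' S) = _
    rw [← Measure.map_apply hmeas hS, hmap, ← Measure.tsum_indicator_apply_singleton _ _ hS]
    congr 1 with w
    congr 1 with w
    rw [Measure.pi_singleton]
    exact Finset.prod_congr rfl fun i _ => p.toMeasure_apply_singleton _ (measurableSet_singleton _)
  rw [Measure.real, h1, tsum_eq_sum (s := Fintype.piFinset fun _ : Fin n => Finset.range M),
    ENNReal.toReal_sum]
  · refine Finset.sum_congr rfl fun w _ => ?_
    by_cases hw : w ∈ S <;> simp [hw, ENNReal.toReal_prod]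
  · intro w _
    by_cases hw : w ∈ S
    · simp only [Set.indicator_of_mem hw]
      exact ENNReal.prod_ne_top fun i _ => p.apply_ne_top _
    · simp [hw]
  · intro w hw
    rw [Set.indicator_apply_eq_zero]
    intro _
    simp only [Fintype.mem_piFinset, Finset.mem_range, not_forall, not_lt] at hw
    obtain ⟨i, hi⟩ := hw
    exact Finset.prod_eq_zero (Finset.mem_univ i) (hM _ hi)

lemma entropy_eq_sum (p : PMF ℕ) {M : ℕ} (hM : ∀ k, M ≤ k → p k = 0) :
    entropy p = ENNReal.ofReal (∑ k ∈ Finset.range M, Real.negMulLog (p k).toReal) := by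
  rw [entropy, tsum_eq_sum (s := Finset.range M) fun k hk => by
    simp [hM k (by simpa using hk)], ENNReal.ofReal_sum_of_nonneg]
  exact fun k _ => Real.negMulLog_nonneg ENNReal.toReal_nonneg
    (p.toReal_apply_le_one k)

lemma mem_dominatedClass_of_forall_eq_zero (ρ : ℕ → ℝ) (p : PMF ℕ) {M : ℕ}
    (hM : ∀ k, M ≤ k → p k = 0) : p ∈ dominatedClass ρ := by
  refine ⟨M, fun n hn => ?_⟩
  have : tailEntropy p n = 0 := by
    rw [tailEntropy, ENNReal.tsum_eq_zero]
    intro k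
    split_ifs with h
    · simp [hM k (hn.trans h)]
    · rfl
  simp [this]

/-! ### Paths of finitely supported distributions -/

/-- The weights of the mixture of the point mass at `0` and the uniform distribution on
`{0, …, M}`, the latter having weight `t`. -/
noncomputable def mixtureWeight (M : ℕ) (t : ℝ) (k : ℕ) : ℝ :=
  t / (M + 1) + if k = 0 then 1 - t else 0

lemma mixtureWeight_nonneg (M : ℕ) (t : unitInterval) (k : ℕ) : 0 ≤ mixtureWeight M t k := by
  have h1 := t.2.1
  have h2 := t.2.2
  unfold mixtureWeight
  split_ifs
  · have : 0 ≤ (t : ℝ) / (M + 1) := by positivity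
    linarith
  · positivity

/-- The mixture of the point mass at `0` and the uniform distribution on `{0, …, M}`. -/
noncomputable def mixturePMF (M : ℕ) (t : unitInterval) : PMF ℕ :=
  PMF.ofFinset (fun k => if k < M + 1 then ENNReal.ofReal (mixtureWeight M t k) else 0)
    (Finset.range (M + 1))
    (by
      rw [Finset.sum_congr rfl fun k hk => if_pos (Finset.mem_range.1 hk),
        ← ENNReal.ofReal_sum_of_nonneg fun k _ => mixtureWeight_nonneg M t k]
      have : ∑ k ∈ Finset.range (M + 1), mixtureWeight M t k = 1 := by
        simp only [mixtureWeight, Finset.sum_add_distrib, Finset.sum_const, Finset.card_range,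
          nsmul_eq_mul, Finset.sum_ite_eq', Finset.mem_range]
        push_cast
        rw [mul_div_cancel₀ _ (by positivity)]
        simp
      simp [this])
    (fun k hk => if_neg (by simpa using hk))

lemma mixturePMF_apply_of_le {M k : ℕ} (t : unitInterval) (hk : M + 1 ≤ k) :
    mixturePMF M t k = 0 := by
  rw [mixturePMF, PMF.ofFinset_apply, if_neg hk.not_gt]

lemma mixturePMF_toReal {M k : ℕ} (t : unitInterval) (hk : k < M + 1) :
    (mixturePMF M t k).toReal = mixtureWeight M t k := by
  rw [mixturePMF, PMF.ofFinset_apply, if_pos hk, ENNReal.toReal_ofReal (mixtureWeight_nonneg M t k)]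

@[fun_prop]
lemma continuous_mixtureWeight (M k : ℕ) :
    Continuous fun t : unitInterval => mixtureWeight M t k := by
  unfold mixtureWeight
  split_ifs <;> fun_prop

/-- The entropy of `mixturePMF M t`. -/
noncomputable def mixtureEntropy (M : ℕ) (t : unitInterval) : ℝ :=
  ∑ k ∈ Finset.range (M + 1), Real.negMulLog (mixtureWeight M t k)

lemma continuous_mixtureEntropy (M : ℕ) : Continuous (mixtureEntropy M) :=
  continuous_finsetSum _ fun k _ => Real.continuous_negMulLog.comp (continuous_mixtureWeight M k)

lemma entropy_mixturePMF (M : ℕ) (t : unitInterval) :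
    entropy (mixturePMF M t) = ENNReal.ofReal (mixtureEntropy M t) := by
  rw [entropy_eq_sum _ fun k => mixturePMF_apply_of_le t, mixtureEntropy]
  congr 1
  exact Finset.sum_congr rfl fun k hk => by rw [mixturePMF_toReal t (Finset.mem_range.1 hk)]

lemma mixtureEntropy_nonneg (M : ℕ) (t : unitInterval) : 0 ≤ mixtureEntropy M t := by
  refine Finset.sum_nonneg fun k hk => ?_
  rw [← mixturePMF_toReal t (Finset.mem_range.1 hk)]
  exact Real.negMulLog_nonneg ENNReal.toReal_nonneg
    (PMF.toReal_apply_le_one _ k)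

/-- Intermediate values between the point mass (`t = 0`) and the uniform law (`t = 1`). -/
lemma exists_mixtureEntropy_eq (M : ℕ) {h : ℝ} (h0 : 0 ≤ h) (h1 : h ≤ Real.log (M + 1)) :
    ∃ t, mixtureEntropy M t = h := by
  refine mem_range_of_exists_le_of_exists_ge (continuous_mixtureEntropy M) ⟨0, ?_⟩ ⟨1, ?_⟩
  · refine le_of_eq_of_le (Finset.sum_eq_zero fun k _ => ?_) h0
    by_cases hk : k = 0 <;> simp [mixtureWeight, hk]
  · refine h1.trans_eq ?_
    have hM : (M : ℝ) + 1 ≠ 0 := by positivity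
    simp [mixtureEntropy, mixtureWeight, Real.negMulLog]
    field_simp

/-! ### Necessity of separability -/

/-- The parameters at which the rule `Φ` predicts `c` from step `N` on with probability at least
one half. -/
def stableSet (Φ : List ℕ → Bool) (c : Bool) (M N : ℕ) : Set unitInterval :=
  {t | ∀ n, 1 / 2 ≤ (iidLaw (mixturePMF M t)).real
    {x | ∀ j < n, N ≤ j → Φ (firstObs x j) = c}}

/-- Each finite horizon `n` gives a closed condition, its probability being a finite sum of products
of weights continuous in `t`. The infinite-horizon probability need not be continuous. -/
lemma isClosed_stableSet (Φ : List ℕ → Bool) (c : Bool) (M N : ℕ) :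
    IsClosed (stableSet Φ c M N) := by
  classical
  rw [stableSet, Set.ofPred_forall]
  refine isClosed_iInter fun n => isClosed_le continuous_const ?_
  let S : Set (Fin n → ℕ) :=
    {w | ∀ (j : ℕ) (hj : j < n), N ≤ j →
      Φ (List.ofFn fun i : Fin j => w ⟨i, i.2.trans hj⟩) = c}
  have hS (t : unitInterval) := iidLaw_real_eq_sum (mixturePMF M t)
    (fun k => mixturePMF_apply_of_le t) n S
  change Continuous fun t => (iidLaw (mixturePMF M t)).real {x | (fun i : Fin n => x i) ∈ S}
  simp_rw [hS]
  refine continuous_finsetSum _ fun w hw => ?_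
  split_ifs
  · refine continuous_finsetProd _ fun i _ => ?_
    have hi : w i < M + 1 := by simpa using Fintype.mem_piFinset.1 hw i
    simp_rw [mixturePMF_toReal _ hi]
    fun_prop
  · exact continuous_const

lemma stableSet_mono (Φ : List ℕ → Bool) (c : Bool) (M : ℕ) : Monotone (stableSet Φ c M) :=
  fun _ _ hN _ ht n => (ht n).trans
    (measureReal_mono fun _ hx j hj hNj => hx j hj (hN.trans hNj))

/-- Continuity of the measure from above, as the horizon grows. -/
lemma mem_stableSet_iff (Φ : List ℕ → Bool) (c : Bool) (M N : ℕ) (t : unitInterval) :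
    t ∈ stableSet Φ c M N ↔ 1 / 2 ≤ (iidLaw (mixturePMF M t)).real
      {x | ∀ j, N ≤ j → Φ (firstObs x j) = c} := by
  constructor
  · intro ht
    have hmeas (n : ℕ) : MeasurableSet {x : ℕ → ℕ | ∀ j < n, N ≤ j → Φ (firstObs x j) = c} := by
      simp only [Set.ofPred_forall]
      exact MeasurableSet.iInter fun j => MeasurableSet.iInter fun _ => MeasurableSet.iInter fun _ =>
        measurable_comp_firstObs Φ j (measurableSet_singleton c)
    have hlim := tendsto_measure_iInter_atTop (μ := iidLaw (mixturePMF M t))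
      (s := fun n : ℕ => {x : ℕ → ℕ | ∀ j < n, N ≤ j → Φ (firstObs x j) = c})
      (fun n => (hmeas n).nullMeasurableSet)
      (fun m n hmn x hx j hj => hx j (hj.trans_le hmn)) ⟨0, measure_ne_top _ _⟩
    have heq : (⋂ n : ℕ, {x : ℕ → ℕ | ∀ j < n, N ≤ j → Φ (firstObs x j) = c}) =
        {x | ∀ j, N ≤ j → Φ (firstObs x j) = c} := by
      ext x
      simp only [Set.mem_iInter, Set.mem_ofPred_eq]
      exact ⟨fun h j => h (j + 1) j (Nat.lt_succ_self j), fun h n j _ => h j⟩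
    rw [heq] at hlim
    exact ge_of_tendsto' ((ENNReal.tendsto_toReal (measure_ne_top _ _)).comp hlim) ht
  · exact fun h n => h.trans (measureReal_mono fun x hx j _ => hx j)

/-- If `c` is right, the probability of saying `c` from step `N` on tends to `1`; if `c` is wrong,
it is `0` for every `N`. Any threshold strictly between would serve as well as `1 / 2`. -/
lemma mem_predictedSet_iff_exists_mem_stableSet {A : Set ℝ} {Φ : List ℕ → Bool} {M : ℕ}
    {t : unitInterval}
    (hΦ : ∀ᵐ x ∂(iidLaw (mixturePMF M t)), ∀ᶠ n in atTop,
      mixtureEntropy M t ∈ predictedSet A (Φ (firstObs x n))) (c : Bool) :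
    mixtureEntropy M t ∈ predictedSet A c ↔ ∃ N, t ∈ stableSet Φ c M N := by
  have hstab (b : Bool) (hb : mixtureEntropy M t ∈ predictedSet A b) :
      ∀ᵐ x ∂(iidLaw (mixturePMF M t)), ∀ᶠ n in atTop, Φ (firstObs x n) = b := by
    filter_upwards [hΦ] with x hx
    filter_upwards [hx] with n hn
    by_contra hne
    rw [Bool.eq_not.2 hne, mem_predictedSet_not_iff (mixtureEntropy_nonneg M t)] at hn
    exact hn hb
  constructor
  · intro hc
    have hlim := tendsto_measure_iUnion_atTop (μ := iidLaw (mixturePMF M t))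
      (s := fun N : ℕ => {x : ℕ → ℕ | ∀ j, N ≤ j → Φ (firstObs x j) = c})
      (fun m n hmn x hx j hj => hx j (hmn.trans hj))
    have hone : iidLaw (mixturePMF M t)
        (⋃ N : ℕ, {x : ℕ → ℕ | ∀ j, N ≤ j → Φ (firstObs x j) = c}) = 1 := by
      rw [← measure_univ (μ := iidLaw (mixturePMF M t))]
      refine measure_congr (eventuallyEq_univ.2 ?_)
      filter_upwards [hstab c hc] with x hx
      simpa [eventually_atTop] using hx
    rw [hone] at hlim
    have hlim' := (ENNReal.tendsto_toReal ENNReal.one_ne_top).comp hlim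
    obtain ⟨N, hN⟩ := (hlim'.eventually (lt_mem_nhds (show (1 / 2 : ℝ) < (1 : ℝ≥0∞).toReal by
      norm_num))).exists
    exact ⟨N, (mem_stableSet_iff Φ c M N t).2 hN.le⟩
  · rintro ⟨N, hN⟩
    by_contra hc
    rw [← mem_predictedSet_not_iff (mixtureEntropy_nonneg M t)] at hc
    have h0 : (iidLaw (mixturePMF M t)) {x | ∀ j, N ≤ j → Φ (firstObs x j) = c} = 0 := by
      refine measure_eq_zero_iff_ae_notMem.2 ?_
      filter_upwards [hstab _ hc] with x hx hx'
      obtain ⟨j, hj, hNj⟩ := (hx.and (eventually_ge_atTop N)).exists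
      rw [hx' j hNj] at hj
      simp at hj
    have := (mem_stableSet_iff Φ c M N t).1 hN
    rw [Measure.real, h0] at this
    norm_num at this

lemma exists_closed_of_predicts {A : Set ℝ} (hA : A ⊆ Set.Ici 0) {Φ : List ℕ → Bool}
    (hΦ : ∀ (M : ℕ) (t : unitInterval), ∀ᵐ x ∂(iidLaw (mixturePMF M t)), ∀ᶠ n in atTop,
      mixtureEntropy M t ∈ predictedSet A (Φ (firstObs x n))) (c : Bool) :
    ∃ F : ℕ → Set ℝ, Monotone F ∧ (∀ n, IsClosed (F n)) ∧ ⋃ n, F n = predictedSet A c := by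
  -- Restricting to `M ≤ N` keeps the union finite, hence closed, and increasing in `N`.
  refine ⟨fun N => ⋃ M ∈ Set.Iic N, mixtureEntropy M '' stableSet Φ c M N, ?_, ?_, ?_⟩
  · intro N N' hN
    exact Set.biUnion_mono (Set.Iic_subset_Iic.2 hN)
      fun M _ => Set.image_mono (stableSet_mono Φ c M hN)
  · exact fun N => (Set.finite_Iic N).isClosed_biUnion fun M _ =>
      ((isClosed_stableSet Φ c M N).isCompact.image (continuous_mixtureEntropy M)).isClosed
  · ext h
    simp only [Set.mem_iUnion]
    constructor
    · rintro ⟨N, M, -, t, ht, rfl⟩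
      exact (mem_predictedSet_iff_exists_mem_stableSet (hΦ M t) c).2 ⟨N, ht⟩
    · intro hh
      obtain ⟨M, hM⟩ := exists_nat_ge (Real.exp h)
      have hlog : h ≤ Real.log (M + 1) :=
        (Real.le_log_iff_exp_le (by positivity)).2 (hM.trans (by simp))
      obtain ⟨t, rfl⟩ := exists_mixtureEntropy_eq M (predictedSet_subset hA c hh) hlog
      obtain ⟨N, hN⟩ := (mem_predictedSet_iff_exists_mem_stableSet (hΦ M t) c).1 hh
      exact ⟨max M N, M, le_max_left M N, t, stableSet_mono Φ c M (le_max_right M N) hN, rfl⟩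

theorem fSigmaSeparable_of_easPredictable (ρ : ℕ → ℝ) {A : Set ℝ} (hA : A ⊆ Set.Ici 0)
    (h : EASPredictable iidLaw (dominatedClass ρ) (entropyLoss A)) :
    FSigmaSeparable A (Set.Ici 0 \ A) := by
  obtain ⟨Φ, hΦ⟩ := h
  have hΦ' (M : ℕ) (t : unitInterval) : ∀ᵐ x ∂(iidLaw (mixturePMF M t)), ∀ᶠ n in atTop,
      mixtureEntropy M t ∈ predictedSet A (Φ (firstObs x n)) := by
    filter_upwards [hΦ _ (mem_dominatedClass_of_forall_eq_zero ρ _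
      fun k => mixturePMF_apply_of_le (M := M) t)] with x hx
    exact (tsum_entropyLoss_lt_top_iff hA (mixtureEntropy_nonneg M t)
      (entropy_mixturePMF M t) Φ x).1 hx
  obtain ⟨F, hFm, hFc, hF⟩ := exists_closed_of_predicts hA hΦ' true
  obtain ⟨G, hGm, hGc, hG⟩ := exists_closed_of_predicts hA hΦ' false
  simp only [predictedSet, if_true, Bool.false_eq_true, if_false] at hF hG
  refine ⟨F, G, hFm, hGm, hF, hG, fun n => ⟨hFc n, hGc n, ?_⟩⟩
  refine Set.disjoint_of_subset ?_ ?_ (Set.disjoint_sdiff_right (s := A) (t := Set.Ici 0))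
  · exact hF ▸ Set.subset_iUnion F n
  · exact hG ▸ Set.subset_iUnion G n

/-! ### Uniform estimation of the entropy -/

/-- The relative frequency of the letter `k` in the string `l`. -/
noncomputable def relFreq (l : List ℕ) (k : ℕ) : ℝ := (l.count k : ℝ) / l.length

/-- The plug-in estimate of the contribution of the letters below `m` to the entropy. -/
noncomputable def plugInEntropy (m : ℕ) (l : List ℕ) : ℝ :=
  ∑ k ∈ Finset.range m, Real.negMulLog (relFreq l k)

@[simp]
lemma length_firstObs {X : Type*} (x : ℕ → X) (n : ℕ) : (firstObs x n).length = n := by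
  simp [firstObs]

lemma firstObs_succ {X : Type*} (x : ℕ → X) (n : ℕ) :
    firstObs x (n + 1) = firstObs x n ++ [x n] := by
  rw [firstObs, List.ofFn_succ_last]
  rfl

lemma take_firstObs {X : Type*} (x : ℕ → X) {a n : ℕ} (h : a ≤ n) :
    (firstObs x n).take a = firstObs x a := by
  refine List.ext_getElem (by simp [h]) fun i h1 h2 => ?_
  simp [firstObs]

lemma relFreq_nonneg (l : List ℕ) (k : ℕ) : 0 ≤ relFreq l k := by
  unfold relFreq; positivity

lemma relFreq_le_one (l : List ℕ) (k : ℕ) : relFreq l k ≤ 1 :=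
  div_le_one_of_le₀ (by exact_mod_cast List.count_le_length) (by positivity)

lemma count_firstObs (x : ℕ → ℕ) (n k : ℕ) :
    ((firstObs x n).count k : ℝ) = ∑ i ∈ Finset.range n, if x i = k then 1 else 0 := by
  induction n with
  | zero => simp [firstObs]
  | succ n ih =>
    rw [firstObs_succ, List.count_append, Finset.sum_range_succ, ← ih]
    simp [List.count_singleton]

lemma iidLaw_map_eval (p : PMF ℕ) (i : ℕ) : (iidLaw p).map (fun x => x i) = p.toMeasure :=
  Measure.infinitePi_map_eval _ i

lemma integral_indicator_eval (p : PMF ℕ) (i k : ℕ) :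
    ∫ x, (if x i = k then 1 else 0 : ℝ) ∂(iidLaw p) = (p k).toReal := by
  rw [← integral_map (φ := fun x : ℕ → ℕ => x i) (f := fun a => if a = k then (1 : ℝ) else 0)
    (measurable_pi_apply i).aemeasurable (measurable_of_countable _).aestronglyMeasurable,
    iidLaw_map_eval]
  have : (fun a : ℕ => if a = k then (1 : ℝ) else 0) = ({k} : Set ℕ).indicator 1 := by
    ext a; simp [Set.indicator_apply]
  rw [this, integral_indicator_one (measurableSet_singleton k), Measure.real,
    p.toMeasure_apply_singleton _ (measurableSet_singleton k)]

/-- Chebyshev's inequality for relative frequencies. -/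
lemma iidLaw_relFreq_deviation_le (p : PMF ℕ) (k : ℕ) {n : ℕ} (hn : 0 < n) {δ : ℝ} (hδ : 0 < δ) :
    iidLaw p {x | δ ≤ |relFreq (firstObs x n) k - (p k).toReal|} ≤
      ENNReal.ofReal (1 / (n * δ ^ 2)) := by
  have hn' : (0 : ℝ) < n := by exact_mod_cast hn
  let Y : ℕ → (ℕ → ℕ) → ℝ := fun i x => if x i = k then 1 else 0
  have hmeas (i : ℕ) : Measurable (Y i) :=
    (measurable_of_countable fun a : ℕ => if a = k then (1 : ℝ) else 0).comp (measurable_pi_apply i)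
  have hbound (i : ℕ) (x : ℕ → ℕ) : Y i x ∈ Set.Icc (0 : ℝ) 1 := by
    simp only [Y]; split_ifs <;> simp
  have hLp (i : ℕ) : MemLp (Y i) 2 (iidLaw p) :=
    MemLp.of_bound (hmeas i).aestronglyMeasurable 1 (ae_of_all _ fun x => by
      rw [Real.norm_eq_abs, abs_of_nonneg (hbound i x).1]; exact (hbound i x).2)
  -- Each indicator has variance at most `1 / 4`; the cruder bound `1` suffices.
  have hvar : ProbabilityTheory.variance (∑ i ∈ Finset.range n, Y i) (iidLaw p) ≤ n := by
    rw [ProbabilityTheory.IndepFun.variance_sum fun i _ => hLp i]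
    · refine (Finset.sum_le_card_nsmul _ _ 1 fun i _ => ?_).trans (by simp)
      refine (ProbabilityTheory.variance_le_sq_of_bounded (ae_of_all _ (hbound i))
        (hmeas i).aemeasurable).trans (by norm_num)
    · intro i _ j _ hij
      have hind : ProbabilityTheory.iIndepFun Y (iidLaw p) :=
        ProbabilityTheory.iIndepFun_infinitePi (P := fun _ : ℕ => p.toMeasure)
          (X := fun _ a => if a = k then (1 : ℝ) else 0) fun _ => measurable_of_countable _
      exact hind.indepFun hij
  have hmean : ∫ x, (∑ i ∈ Finset.range n, Y i) x ∂(iidLaw p) = n * (p k).toReal := by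
    simp only [Finset.sum_apply]
    rw [integral_finsetSum _ fun i _ => (hLp i).integrable (by norm_num)]
    simp only [Y, integral_indicator_eval, Finset.sum_const, Finset.card_range, nsmul_eq_mul]
  have hset : {x | δ ≤ |relFreq (firstObs x n) k - (p k).toReal|} =
      {x | n * δ ≤ |(∑ i ∈ Finset.range n, Y i) x -
        ∫ x, (∑ i ∈ Finset.range n, Y i) x ∂(iidLaw p)|} := by
    ext x
    simp only [Set.mem_ofPred_eq]
    rw [hmean, Finset.sum_apply, ← count_firstObs, relFreq, length_firstObs,
      ← mul_le_mul_iff_right₀ hn', ← abs_of_pos hn', ← abs_mul, abs_of_pos hn', mul_sub,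
      mul_div_cancel₀ _ hn'.ne']
  rw [hset]
  refine (ProbabilityTheory.meas_ge_le_variance_div_sq
    (memLp_finsetSum' _ fun i _ => hLp i) (by positivity)).trans (ENNReal.ofReal_le_ofReal ?_)
  calc _ ≤ (n : ℝ) / (n * δ) ^ 2 := by gcongr
    _ = 1 / (n * δ ^ 2) := by field_simp

lemma exists_modulus_negMulLog {ε : ℝ} (hε : 0 < ε) :
    ∃ δ > 0, ∀ x ∈ Set.Icc (0 : ℝ) 1, ∀ y ∈ Set.Icc (0 : ℝ) 1, |x - y| < δ →
      |Real.negMulLog x - Real.negMulLog y| < ε := by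
  have h := isCompact_Icc.uniformContinuousOn_of_continuous
    (Real.continuous_negMulLog.continuousOn (s := Set.Icc (0 : ℝ) 1))
  simpa only [Real.dist_eq] using Metric.uniformContinuousOn_iff.1 h ε hε

/-- There is a sample size from which the plug-in estimate is accurate up to `1 / (m + 1)`,
uniformly over all distributions, except with probability at most `2⁻ᵐ`. -/
lemma exists_sampleSize (m : ℕ) : ∃ n : ℕ, ∀ p : PMF ℕ,
    iidLaw p {x | 1 / ((m : ℝ) + 1) < |plugInEntropy m (firstObs x n) -
      ∑ k ∈ Finset.range m, Real.negMulLog (p k).toReal|} ≤ ENNReal.ofReal ((1 / 2) ^ m) := by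
  -- There are `m` summands, and `m / (m + 1) ^ 2 ≤ 1 / (m + 1)`.
  obtain ⟨δ, hδ, hmod⟩ := exists_modulus_negMulLog
    (show (0 : ℝ) < 1 / ((m : ℝ) + 1) ^ 2 by positivity)
  -- The union bound over `m` letters costs `m / (n * δ ^ 2)`, which must not exceed `2⁻ᵐ`.
  obtain ⟨n, hn⟩ := exists_nat_ge (m * 2 ^ m / δ ^ 2)
  refine ⟨n + 1, fun p => ?_⟩
  have hsub : {x | 1 / ((m : ℝ) + 1) < |plugInEntropy m (firstObs x (n + 1)) -
      ∑ k ∈ Finset.range m, Real.negMulLog (p k).toReal|} ⊆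
      ⋃ k ∈ Finset.range m, {x | δ ≤ |relFreq (firstObs x (n + 1)) k - (p k).toReal|} := by
    intro x hx
    by_contra hcon
    simp only [Set.mem_iUnion, Set.mem_ofPred_eq, not_exists, not_le] at hcon
    rw [Set.mem_ofPred_eq] at hx
    refine absurd hx (not_lt.2 ?_)
    rw [plugInEntropy, ← Finset.sum_sub_distrib]
    refine (Finset.abs_sum_le_sum_abs _ _).trans ((Finset.sum_le_card_nsmul _ _ _ fun k hk =>
      (hmod _ ⟨relFreq_nonneg _ k, relFreq_le_one _ k⟩ _
        ⟨ENNReal.toReal_nonneg, p.toReal_apply_le_one k⟩ (hcon k hk)).le).trans ?_)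
    rw [Finset.card_range, nsmul_eq_mul, mul_one_div, div_le_div_iff₀ (by positivity)
      (by positivity)]
    nlinarith [(Nat.cast_nonneg m : (0 : ℝ) ≤ m)]
  refine (measure_mono hsub).trans ((measure_biUnion_finset_le _ _).trans ?_)
  refine (Finset.sum_le_card_nsmul _ _ _ fun k _ =>
    iidLaw_relFreq_deviation_le p k n.succ_pos hδ).trans ?_
  rw [Finset.card_range, ← ENNReal.ofReal_nsmul]
  refine ENNReal.ofReal_le_ofReal ?_
  rw [nsmul_eq_mul, mul_one_div, one_div, inv_pow, ← one_div,
    div_le_div_iff₀ (by positivity) (by positivity), one_mul]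
  rw [div_le_iff₀ (by positivity)] at hn
  push_cast
  nlinarith [sq_nonneg δ]

/-- Borel–Cantelli: the exceptional probabilities `2⁻ᵐ` are summable. -/
lemma ae_eventually_plugInEntropy_close {n : ℕ → ℕ}
    (hn : ∀ (m : ℕ) (p : PMF ℕ), iidLaw p {x | 1 / ((m : ℝ) + 1) <
      |plugInEntropy m (firstObs x (n m)) - ∑ k ∈ Finset.range m, Real.negMulLog (p k).toReal|} ≤
        ENNReal.ofReal ((1 / 2) ^ m)) (p : PMF ℕ) :
    ∀ᵐ x ∂(iidLaw p), ∀ᶠ m : ℕ in atTop, |plugInEntropy m (firstObs x (n m)) -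
      ∑ k ∈ Finset.range m, Real.negMulLog (p k).toReal| ≤ 1 / ((m : ℝ) + 1) := by
  filter_upwards [ae_eventually_notMem (ne_top_of_le_ne_top
    summable_geometric_two.tsum_ofReal_ne_top (ENNReal.tsum_le_tsum fun m => hn m p))] with x hx
  filter_upwards [hx] with m hm
  exact not_lt.1 hm

lemma entropy_eq_add_tailEntropy (p : PMF ℕ) (m : ℕ) :
    entropy p = ENNReal.ofReal (∑ k ∈ Finset.range m, Real.negMulLog (p k).toReal) +
      tailEntropy p m := by
  have hfin : ENNReal.ofReal (∑ k ∈ Finset.range m, Real.negMulLog (p k).toReal) =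
      ∑' k : ℕ, if k < m then ENNReal.ofReal (Real.negMulLog (p k).toReal) else 0 := by
    rw [tsum_eq_sum (s := Finset.range m) fun k hk => if_neg (by simpa using hk),
      Finset.sum_congr rfl fun k hk => if_pos (Finset.mem_range.1 hk),
      ENNReal.ofReal_sum_of_nonneg fun k _ =>
        Real.negMulLog_nonneg ENNReal.toReal_nonneg (p.toReal_apply_le_one k)]
  rw [hfin, tailEntropy, ← ENNReal.tsum_add, entropy]
  refine tsum_congr fun k => ?_
  rcases lt_or_ge k m with h | h
  · simp [h, h.not_ge]
  · simp [h, h.not_gt]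

lemma entropy_ne_top_of_mem_dominatedClass {ρ : ℕ → ℝ} {p : PMF ℕ} (hp : p ∈ dominatedClass ρ) :
    entropy p ≠ ∞ := by
  obtain ⟨N, hN⟩ := hp
  rw [entropy_eq_add_tailEntropy p N]
  exact ENNReal.add_ne_top.2 ⟨ENNReal.ofReal_ne_top,
    ne_top_of_le_ne_top ENNReal.ofReal_ne_top (hN N le_rfl)⟩

lemma eventually_abs_partialEntropy_sub_le {ρ : ℕ → ℝ} (hρ : ∀ n, 0 ≤ ρ n) {p : PMF ℕ}
    (hp : p ∈ dominatedClass ρ) :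
    ∀ᶠ m in atTop, |∑ k ∈ Finset.range m, Real.negMulLog (p k).toReal - (entropy p).toReal| ≤
      ρ m := by
  obtain ⟨N, hN⟩ := hp
  filter_upwards [eventually_ge_atTop N] with m hm
  have htail := hN m hm
  rw [entropy_eq_add_tailEntropy p m, ENNReal.toReal_add ENNReal.ofReal_ne_top
    (ne_top_of_le_ne_top ENNReal.ofReal_ne_top htail), ENNReal.toReal_ofReal
    (Finset.sum_nonneg fun k _ =>
      Real.negMulLog_nonneg ENNReal.toReal_nonneg (p.toReal_apply_le_one k)),
    sub_add_cancel_left, abs_neg, abs_of_nonneg ENNReal.toReal_nonneg]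
  exact ENNReal.toReal_le_of_le_ofReal (hρ m) htail

/-! ### Decisions from estimates of known accuracy -/

/-- The set `S` comes within distance `r` of the point `e`. -/
def IsNear (S : Set ℝ) (e r : ℝ) : Prop := ∃ y ∈ S, |e - y| ≤ r

lemma IsNear.mono {S T : Set ℝ} (hST : S ⊆ T) {e r : ℝ} (h : IsNear S e r) : IsNear T e r :=
  let ⟨y, hy, hyr⟩ := h
  ⟨y, hST hy, hyr⟩

/-- A point of `S` within `r m` of `e m` would be within `2 * r m` of `h`, but some ball about `h`
misses `S`. -/
lemma eventually_not_isNear {S : Set ℝ} (hS : IsClosed S) {h : ℝ} (hh : h ∉ S) {e r : ℕ → ℝ}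
    (hr : Tendsto r atTop (𝓝 0)) (he : ∀ᶠ m in atTop, |e m - h| ≤ r m) :
    ∀ᶠ m in atTop, ¬ IsNear S (e m) (r m) := by
  obtain ⟨ε, hε, hball⟩ := Metric.isOpen_iff.1 hS.isOpen_compl h hh
  filter_upwards [he, hr.eventually (gt_mem_nhds (half_pos hε))] with m hm hrm
  rintro ⟨y, hy, hyr⟩
  refine hball ?_ hy
  rw [Metric.mem_ball, Real.dist_eq, abs_sub_comm]
  have := abs_sub_le h (e m) y
  rw [abs_sub_comm h (e m)] at this
  linarith

/-- A sequence of decisions that is eventually right on any two `F_σ`-separable sets, when based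
on estimates of known accuracy. -/
lemma exists_decision {A B : Set ℝ} (hAB : FSigmaSeparable A B) {r : ℕ → ℝ}
    (hr : Tendsto r atTop (𝓝 0)) :
    ∃ D : ℕ → ℝ → Bool, ∀ (h : ℝ) (e : ℕ → ℝ), (∀ᶠ m in atTop, |e m - h| ≤ r m) →
      (h ∈ A → ∀ᶠ m in atTop, D m (e m) = true) ∧ (h ∈ B → ∀ᶠ m in atTop, D m (e m) = false) := by
  classical
  obtain ⟨F, G, hF, hG, rfl, rfl, hFG⟩ := hAB
  refine ⟨fun m e => decide (∃ j, IsNear (F j) e (r m) ∧ ¬ IsNear (G j) e (r m)),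
    fun h e he => ⟨fun hh => ?_, fun hh => ?_⟩⟩
  · obtain ⟨j, hj⟩ := Set.mem_iUnion.1 hh
    filter_upwards [he, eventually_not_isNear (hFG j).2.1
      (Set.disjoint_left.1 (hFG j).2.2 hj) hr he] with m hm hfar
    exact decide_eq_true ⟨j, ⟨h, hj, hm⟩, hfar⟩
  · obtain ⟨j, hj⟩ := Set.mem_iUnion.1 hh
    filter_upwards [he, eventually_not_isNear (hFG j).1
      (Set.disjoint_right.1 (hFG j).2.2 hj) hr he] with m hm hfar
    refine decide_eq_false ?_
    rintro ⟨i, hi, hi'⟩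
    -- With `h ∈ G j`: for `i ≤ j`, `F i ⊆ F j` is too far from the estimate; for `i ≥ j`, `G i`
    -- contains `h` and is near it.
    rcases le_total i j with hij | hij
    · exact hfar (hi.mono (hF hij))
    · exact hi' (IsNear.mono (hG hij) ⟨h, hj, hm⟩)

/-- Lets the stage grow slowly enough that its sample is already available at time `n`. -/
lemma exists_stage (a : ℕ → ℕ) :
    ∃ s : ℕ → ℕ, Tendsto s atTop atTop ∧ ∀ᶠ n in atTop, a (s n) ≤ n := by
  refine ⟨fun n => Nat.findGreatest (fun m => a m ≤ n) n, tendsto_atTop.2 fun m => ?_, ?_⟩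
  · filter_upwards [eventually_ge_atTop (max m (a m))] with n hn
    exact Nat.le_findGreatest ((le_max_left _ _).trans hn) ((le_max_right _ _).trans hn)
  -- Once `a 0 ≤ n`, the default value `0` of the search is itself admissible.
  · filter_upwards [eventually_ge_atTop (a 0)] with n hn
    exact Nat.findGreatest_spec (P := fun m => a m ≤ n) (Nat.zero_le n) hn

theorem easPredictable_of_fSigmaSeparable {ρ : ℕ → ℝ} (hρ_nonneg : ∀ n, 0 ≤ ρ n)
    (hρ : Tendsto ρ atTop (𝓝 0)) {A : Set ℝ} (hA : A ⊆ Set.Ici 0)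
    (h : FSigmaSeparable A (Set.Ici 0 \ A)) :
    EASPredictable iidLaw (dominatedClass ρ) (entropyLoss A) := by
  have hr : Tendsto (fun m : ℕ => 1 / ((m : ℝ) + 1) + ρ m) atTop (𝓝 0) := by
    simpa using tendsto_one_div_add_atTop_nhds_zero_nat.add hρ
  obtain ⟨D, hD⟩ := exists_decision h hr
  choose a ha using exists_sampleSize
  obtain ⟨s, hs, has⟩ := exists_stage a
  -- Truncating to `a (s n)` observations leaves one estimate per stage, so Borel–Cantelli over
  -- stages covers all times.
  let Φ : List ℕ → Bool := fun l =>
    D (s l.length) (plugInEntropy (s l.length) (l.take (a (s l.length))))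
  have hΦ (x : ℕ → ℕ) {n : ℕ} (hn : a (s n) ≤ n) :
      Φ (firstObs x n) = D (s n) (plugInEntropy (s n) (firstObs x (a (s n)))) := by
    simp only [Φ, length_firstObs, take_firstObs x hn]
  clear_value Φ
  refine ⟨Φ, fun p hp => ?_⟩
  filter_upwards [ae_eventually_plugInEntropy_close ha p] with x hx
  rw [tsum_entropyLoss_lt_top_iff hA ENNReal.toReal_nonneg
    (ENNReal.ofReal_toReal (entropy_ne_top_of_mem_dominatedClass hp)).symm]
  have hclose : ∀ᶠ m : ℕ in atTop, |plugInEntropy m (firstObs x (a m)) - (entropy p).toReal| ≤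
      1 / ((m : ℝ) + 1) + ρ m := by
    filter_upwards [hx, eventually_abs_partialEntropy_sub_le hρ_nonneg hp] with m h1 h2
    exact (abs_sub_le _ _ _).trans (add_le_add h1 h2)
  obtain ⟨htrue, hfalse⟩ := hD _ _ hclose
  by_cases hmem : (entropy p).toReal ∈ A
  · filter_upwards [has, hs.eventually (htrue hmem)] with n hn hDn
    rw [hΦ x hn, hDn]
    simpa [predictedSet] using hmem
  · have hmem' : (entropy p).toReal ∈ Set.Ici 0 \ A := ⟨ENNReal.toReal_nonneg, hmem⟩
    filter_upwards [has, hs.eventually (hfalse hmem')] with n hn hDn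
    rw [hΦ x hn, hDn]
    simpa [predictedSet] using hmem

theorem theorem5 (ρ : ℕ → ℝ) (hρ_nonneg : ∀ n, 0 ≤ ρ n) (hρ : Tendsto ρ atTop (𝓝 0))
    (A : Set ℝ) (hA : A ⊆ Set.Ici 0) :
    EASPredictable iidLaw (dominatedClass ρ) (entropyLoss A) ↔
      FSigmaSeparable A (Set.Ici 0 \ A) :=
  ⟨fSigmaSeparable_of_easPredictable ρ hA, easPredictable_of_fSigmaSeparable hρ_nonneg hρ hA⟩
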